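/- Consider the linear system $X_{t+1}=AX_t+BU_t+HW_{t+1}$ with $A\in\mathbb R^{n\times n}$, $B\in\mathbb R^{n\times m}$, $H\in\mathbb R^{n\times d}$ of full row rank $n$. The noise $(W_t)$ is i.i.d. with a zero-mean law $\mathbb P_W$ on $\mathbb R^d$ that is not singular with respect to Lebesgue measure, has finite fourth moment, and has covariance $\Sigma_W\succ0$. Let $Q\succ0$, $R\succ0$, $Q^c\succeq0$ be symmetric matrices, and consider the risk functional $g(x,u)=x^\top Q^c x+u^\top R^c u$ with $R^c=0$. Let $A_K=A+BK$ and let $\mathcal S$ be the set of $K\in\mathbb R^{m\times n}$ for which $A_K$ has spectral radius less than $1$. For $K\in\mathcal S$ let $\Sigma_K$ be the unique positive definite solution of $\Sigma_K=A_K\Sigma_KA_K^\top+H\Sigma_WH^\top$, put $J(K)=\operatorname{tr}\big((Q+K^\top RK)\Sigma_K\big)$ and $$\gamma_N^2(K)=4\operatorname{tr}\big(Q^cH\Sigma_WH^\top Q^c(\Sigma_K-H\Sigma_WH^\top)\big)+\mathbb E\Big[\operatorname{tr}\big(Q^cH(W_1W_1^\top-\Sigma_W)H^\top\big)^2\Big].$$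 For $\bar\beta\in\mathbb R$, $K\in\mathcal S$ and $\lambda\ge0$ define the Lagrangian $L(K,\lambda)=J(K)+\lambda(\gamma_N^2(K)-\bar\beta)$, and consider the constrained problem $$\min J(K)\quad\text{subject to}\quad \gamma_N^2(K)\le\bar\beta,\ K\in\mathcal S,\ (A_K,H)\text{ controllable}.$$ Assume Slater's condition: some $K\in\mathcal S$ satisfies $\gamma_N^2(K)<\bar\beta$. Then $\Sigma_K$ exists and is unique for every $K\in\mathcal S$; for every $\lambda\ge0$ the function $L(\cdot,\lambda)$ has a unique global minimizer $K^*(\lambda)$ over $\mathcal S$; and the minimum $$\lambda^*=\min\{\lambda\ge0:\ \gamma_N^2(K^*(\lambda))\le\bar\beta\}$$ exists. Moreover: 1. $(K^*(\lambda^*),\lambda^*)$ is a saddle point of $L$ on $\mathcal S\times[0,\infty)$: $L(K^*(\lambda^*),\lambda)\le L(K^*(\lambda^*),\lambda^*)\le L(K,\lambda^*)$ for all $K\in\mathcal S$ and $\lambda\ge0$. 2. Complementary slackness holds: $\lambda^*\big(\gamma_N^2(K^*(\lambda^*))-\bar\beta\big)=0$. 3. Strong duality holds: $K^*(\lambda^*)$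 is feasible for the constrained problem and attains its minimum, $\lambda^*$ attains the maximum of the dual problem $\sup_{\lambda\ge0}\inf_{K\in\mathcal S}L(K,\lambda)$, and the two optimal values both equal $J(K^*(\lambda^*))$. -/

import Mathlib

open MeasureTheory ProbabilityTheory

noncomputable section

/-- Data of the constrained stochastic LQR problem: the dynamics
`X_{t+1} = A X_t + B U_t + H W_{t+1}`, the performance weights `Q`, `R`, the weights `Qc`, `Rc`
of the risk functional `g(x,u) = xᵀ Qc x + uᵀ Rc u`, and the common law `noise` of the `W_t`.
The assumptions on these data are hypotheses of the theorem. -/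
structure LQRData (n m d : ℕ) where
  A : Matrix (Fin n) (Fin n) ℝ
  B : Matrix (Fin n) (Fin m) ℝ
  H : Matrix (Fin n) (Fin d) ℝ
  Q : Matrix (Fin n) (Fin n) ℝ
  R : Matrix (Fin m) (Fin m) ℝ
  Qc : Matrix (Fin n) (Fin n) ℝ
  Rc : Matrix (Fin m) (Fin m) ℝ
  noise : Measure (Fin d → ℝ)

/-- A real square matrix is Schur stable if its (complex) spectral radius is less than one. -/
def IsSchurStable {n : ℕ} (M : Matrix (Fin n) (Fin n) ℝ) : Prop :=
  spectralRadius ℂ (M.map (algebraMap ℝ ℂ)) < 1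

/-- The Kalman controllability matrix `[H, M H, …, M^(n-1) H]`. -/
def controllabilityMatrix {n d : ℕ} (M : Matrix (Fin n) (Fin n) ℝ)
    (H : Matrix (Fin n) (Fin d) ℝ) : Matrix (Fin n) (Fin n × Fin d) ℝ :=
  Matrix.of fun i kj => (M ^ (kj.1 : ℕ) * H) i kj.2

/-- Controllability of the pair `(M, H)`. -/
def IsControllablePair {n d : ℕ} (M : Matrix (Fin n) (Fin n) ℝ)
    (H : Matrix (Fin n) (Fin d) ℝ) : Prop :=
  (controllabilityMatrix M H).rank = n

/-- The covariance matrix of a law on `ℝ^d`. -/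
def covMat {d : ℕ} (P : Measure (Fin d → ℝ)) : Matrix (Fin d) (Fin d) ℝ :=
  Matrix.of fun i j => cov[fun w : Fin d → ℝ => w i, fun w : Fin d → ℝ => w j; P]

/-- The assumptions on the law of the noise: a zero-mean probability measure, not singular with
respect to Lebesgue measure (its Lebesgue decomposition has a nonzero density part), with finite
fourth moment and positive definite covariance. -/
structure IsAdmissibleNoise {d : ℕ} (P : Measure (Fin d → ℝ)) : Prop where
  isProbabilityMeasure : IsProbabilityMeasure P
  nonsingular : ¬ (P ⟂ₘ (volume : Measure (Fin d → ℝ)))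
  fourth_moment : Integrable (fun w : Fin d → ℝ => ‖w‖ ^ 4) P
  mean_zero : ∀ i, ∫ w, w i ∂P = 0
  cov_posDef : (covMat P).PosDef

namespace LQRData

variable {n m d : ℕ} (D : LQRData n m d)

/-- The closed-loop matrix `A_K = A + B K`. -/
def closedLoop (K : Matrix (Fin m) (Fin n) ℝ) : Matrix (Fin n) (Fin n) ℝ :=
  D.A + D.B * K

/-- The set `𝒮` of stabilizing policies. -/
def stabilizing : Set (Matrix (Fin m) (Fin n) ℝ) :=
  {K | IsSchurStable (D.closedLoop K)}

/-- The covariance `H Σ_W Hᵀ` of the noise entering the state. -/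
def noiseCov : Matrix (Fin n) (Fin n) ℝ :=
  D.H * covMat D.noise * D.H.transpose

/-- `X` is a positive definite solution of `X = A_K X A_Kᵀ + H Σ_W Hᵀ`. -/
def IsStateCov (K : Matrix (Fin m) (Fin n) ℝ) (X : Matrix (Fin n) (Fin n) ℝ) : Prop :=
  X.PosDef ∧ X = D.closedLoop K * X * (D.closedLoop K).transpose + D.noiseCov

/-- `Σ_K`, the positive definite solution of the Lyapunov equation. Its existence and uniqueness
for stabilizing `K` is part of the conclusion of the theorem. -/
def stateCov (K : Matrix (Fin m) (Fin n) ℝ) : Matrix (Fin n) (Fin n) ℝ :=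
  Classical.epsilon (D.IsStateCov K)

/-- `Q_K = Q + Kᵀ R K`. -/
def QK (K : Matrix (Fin m) (Fin n) ℝ) : Matrix (Fin n) (Fin n) ℝ :=
  D.Q + K.transpose * D.R * K

/-- `Q_K^c = Q^c + Kᵀ R^c K`. -/
def QcK (K : Matrix (Fin m) (Fin n) ℝ) : Matrix (Fin n) (Fin n) ℝ :=
  D.Qc + K.transpose * D.Rc * K

/-- The LQR cost `J(K) = tr(Q_K Σ_K)`. -/
def cost (K : Matrix (Fin m) (Fin n) ℝ) : ℝ :=
  (D.QK K * D.stateCov K).trace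

/-- `m₄[M] = 𝔼[tr(M H (W Wᵀ - Σ_W) Hᵀ)²]`. -/
def m4 (M : Matrix (Fin n) (Fin n) ℝ) : ℝ :=
  ∫ w, (M * D.H * (Matrix.vecMulVec w w - covMat D.noise) * D.H.transpose).trace ^ 2 ∂D.noise

/-- The asymptotic conditional variance
`γ_N²(K) = 4 tr(Q_K^c H Σ_W Hᵀ Q_K^c (Σ_K - H Σ_W Hᵀ)) + m₄[Q_K^c]`. -/
def gammaNSq (K : Matrix (Fin m) (Fin n) ℝ) : ℝ :=
  4 * (D.QcK K * D.noiseCov * D.QcK K * (D.stateCov K - D.noiseCov)).trace + D.m4 (D.QcK K)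

/-- The Lagrangian `L(K, lam) = J(K) + lam (γ_N²(K) - β)`. -/
def lagrangian (β : ℝ) (K : Matrix (Fin m) (Fin n) ℝ) (lam : ℝ) : ℝ :=
  D.cost K + lam * (D.gammaNSq K - β)

/-- `K` is a global minimizer of `L(·, lam)` over the stabilizing policies. -/
def IsLagrangianMinimizer (β lam : ℝ) (K : Matrix (Fin m) (Fin n) ℝ) : Prop :=
  K ∈ D.stabilizing ∧ ∀ K' ∈ D.stabilizing, D.lagrangian β K lam ≤ D.lagrangian β K' lam

/-- `K*(lam)`, the global minimizer of `L(·, lam)` over the stabilizing policies. Its existence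
and uniqueness for `lam ≥ 0` is part of the conclusion of the theorem. -/
def optPolicy (β lam : ℝ) : Matrix (Fin m) (Fin n) ℝ :=
  Classical.epsilon (D.IsLagrangianMinimizer β lam)

/-- The feasible set of the constrained problem: stabilizing `K` with `(A_K, H)` controllable and
`γ_N²(K) ≤ β`. -/
def feasible (β : ℝ) : Set (Matrix (Fin m) (Fin n) ℝ) :=
  {K | K ∈ D.stabilizing ∧ IsControllablePair (D.closedLoop K) D.H ∧ D.gammaNSq K ≤ β}

/-- The dual function `lam ↦ inf_{K ∈ 𝒮} L(K, lam)`. -/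
def dualFunction (β lam : ℝ) : ℝ :=
  sInf ((fun K => D.lagrangian β K lam) '' D.stabilizing)

/-- `(K, lam)` is a saddle point of the Lagrangian on `𝒮 × [0, ∞)`. -/
def IsLagrangianSaddlePoint (β : ℝ) (K : Matrix (Fin m) (Fin n) ℝ) (lam : ℝ) : Prop :=
  K ∈ D.stabilizing ∧ 0 ≤ lam ∧
    IsSaddlePointOn D.stabilizing (Set.Ici (0 : ℝ)) (D.lagrangian β) K lam

end LQRData

end

/-! Since R^c = 0, the risk is affine in the state covariance: γ_N²(K) = tr(W Σ_K) + const, with W =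
4 Qᶜ N Qᶜ ⪰ 0 and N = H Σ_W Hᵀ ≻ 0. Hence L(·, λ) is, up to a constant, an ordinary LQR cost with Q
replaced by Q + λW ≻ 0 (`lagrangian_eq`).

Minimization takes place over pairs (K, X) with X ⪰ 0 solving the closed-loop Lyapunov equation.
This set is closed, N ≻ 0 forces its policies to be stable, and cost sublevel sets in it are
compact. So a minimizer exists; one policy improvement step shows that it is greedy for its own
value matrix, and completing the square then gives uniqueness (`exists_unique_lqrCost_minimizer`).

Compactness and uniqueness make λ ↦ K*(λ) continuous. The multipliers with feasible K*(λ) therefore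
form a closed set, nonempty by Slater's condition, and if its least element is positive the
constraint is active there (`exists_isLeast_multiplier`). Complementary slackness then yields the
saddle point and strong duality, without any convexity in K. -/

open Filter Topology
open scoped Matrix

/-! ### Trace inequalities for positive semidefinite matrices. -/

namespace Matrix

lemma tendsto_nhds_iff_apply {m n ι : Type*} {l : Filter ι} {R : Type*} [TopologicalSpace R]
    {f : ι → Matrix m n R} {X : Matrix m n R} :
    Tendsto f l (𝓝 X) ↔ ∀ i j, Tendsto (fun k => f k i j) l (𝓝 (X i j)) :=
  tendsto_pi_nhds.trans (forall_congr' fun _ => tendsto_pi_nhds)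

variable {n m : Type*} [Fintype n] [Fintype m]

section
variable [DecidableEq n]
open scoped Matrix.Norms.L2Operator MatrixOrder

lemma PosSemidef.trace_mul_nonneg {X Y : Matrix n n ℝ} (hX : X.PosSemidef) (hY : Y.PosSemidef) :
    0 ≤ (X * Y).trace := by
  obtain ⟨B, rfl⟩ := CStarAlgebra.nonneg_iff_eq_star_mul_self.mp hY.nonneg
  rw [← mul_assoc, trace_mul_comm, ← mul_assoc]
  exact (hX.mul_mul_conjTranspose_same B).trace_nonneg

lemma PosDef.exists_pos_sub_smul_one_posSemidef {X : Matrix n n ℝ} (hX : X.PosDef) :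
    ∃ c : ℝ, 0 < c ∧ (X - c • (1 : Matrix n n ℝ)).PosSemidef := by
  cases isEmpty_or_nonempty n
  · exact ⟨1, one_pos, by rw [Subsingleton.elim (X - (1 : ℝ) • (1 : Matrix n n ℝ)) 0]; exact .zero⟩
  obtain ⟨r, hr, h⟩ := (CFC.exists_pos_algebraMap_le_iff (A := Matrix n n ℝ) (a := X)
    hX.isHermitian.isSelfAdjoint).2 (fun x hx =>
      (isStrictlyPositive_iff_posDef.2 hX).spectrum_pos hx)
  exact ⟨r, hr, by rwa [Algebra.algebraMap_eq_smul_one, le_iff] at h⟩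

end

/-- A positive lower bound c of the spectrum works: X - c·1 ⪰ 0 is traced against Y. All coercivity
estimates below rest on this. -/
lemma PosDef.exists_pos_trace_mul_ge [DecidableEq n] {X : Matrix n n ℝ} (hX : X.PosDef) :
    ∃ c : ℝ, 0 < c ∧ ∀ Y : Matrix n n ℝ, Y.PosSemidef → c * Y.trace ≤ (X * Y).trace := by
  obtain ⟨c, hc, h⟩ := hX.exists_pos_sub_smul_one_posSemidef
  refine ⟨c, hc, fun Y hY => ?_⟩
  have := h.trace_mul_nonneg hY
  simp only [sub_mul, smul_mul_assoc, one_mul, trace_sub, trace_smul, smul_eq_mul] at this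
  linarith

lemma PosSemidef.transpose_mul_mul_same {k : Type*} [Fintype k] {X : Matrix n n ℝ}
    (hX : X.PosSemidef) (B : Matrix n k ℝ) : (Bᵀ * X * B).PosSemidef := by
  simpa using hX.conjTranspose_mul_mul_same B

lemma PosSemidef.mul_mul_transpose_same {k : Type*} [Fintype k] {X : Matrix n n ℝ}
    (hX : X.PosSemidef) (B : Matrix k n ℝ) : (B * X * Bᵀ).PosSemidef := by
  simpa using hX.mul_mul_conjTranspose_same B

lemma sq_apply_le_trace_transpose_mul_self (Y : Matrix m n ℝ) (i : m) (j : n) :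
    Y i j ^ 2 ≤ (Yᵀ * Y).trace := by
  have h : (Yᵀ * Y).trace = ∑ j, ∑ i, Y i j ^ 2 := by
    simp [trace, mul_apply, sq]
  rw [h]
  calc Y i j ^ 2 ≤ ∑ i, Y i j ^ 2 :=
        Finset.single_le_sum (f := fun i => Y i j ^ 2) (fun _ _ => sq_nonneg _) (Finset.mem_univ i)
    _ ≤ _ := Finset.single_le_sum (f := fun j => ∑ i, Y i j ^ 2)
        (fun _ _ => Finset.sum_nonneg fun _ _ => sq_nonneg _) (Finset.mem_univ j)

/-- Testing the form on e_i ± e_j gives |X_ij| ≤ (X_ii + X_jj) / 2. -/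
lemma PosSemidef.abs_apply_le_trace [DecidableEq n] {X : Matrix n n ℝ} (hX : X.PosSemidef) (i j : n) :
    |X i j| ≤ X.trace := by
  have hd : ∀ i, X i i ≤ X.trace := fun i =>
    Finset.single_le_sum (f := fun i => X i i) (fun _ _ => hX.diag_nonneg) (Finset.mem_univ i)
  have hs : X j i = X i j := by simpa using hX.isHermitian.apply i j
  have h1 := hX.dotProduct_mulVec_nonneg (Pi.single i 1 + Pi.single j 1)
  have h2 := hX.dotProduct_mulVec_nonneg (Pi.single i 1 - Pi.single j 1)
  simp [mulVec_add, mulVec_sub, add_dotProduct, sub_dotProduct, dotProduct_add, dotProduct_sub, hs]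
    at h1 h2
  have := hd i
  have := hd j
  rw [abs_le]
  constructor <;> linarith

lemma isClosed_setOf_posSemidef : IsClosed {X : Matrix n n ℝ | X.PosSemidef} := by
  have : {X : Matrix n n ℝ | X.PosSemidef} =
      {X | Xᴴ = X} ∩ ⋂ x : n → ℝ, {X | 0 ≤ star x ⬝ᵥ (X *ᵥ x)} := by
    ext X
    simp [posSemidef_iff_dotProduct_mulVec, IsHermitian]
  rw [this]
  refine (isClosed_eq (by fun_prop) continuous_id).inter (isClosed_iInter fun x => ?_)
  exact isClosed_le continuous_const
    (Continuous.dotProduct continuous_const (Continuous.matrix_mulVec continuous_id continuous_const))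

end Matrix

/-! ### Schur stability and the discrete Lyapunov equation. -/

section Stability
open Matrix

lemma tendsto_map_ofReal_pow_iff {n : ℕ} (M : Matrix (Fin n) (Fin n) ℝ) :
    Tendsto (fun k : ℕ => (M.map (algebraMap ℝ ℂ)) ^ k) atTop (𝓝 0) ↔
      Tendsto (fun k : ℕ => M ^ k) atTop (𝓝 0) := by
  have h : ∀ k : ℕ, (M.map (algebraMap ℝ ℂ)) ^ k = (M ^ k).map (algebraMap ℝ ℂ) := fun k =>
    ((algebraMap ℝ ℂ).mapMatrix.map_pow M k).symm
  simp_rw [h, tendsto_nhds_iff_apply]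
  refine forall₂_congr fun i j => ?_
  constructor
  · intro h
    have := (Complex.continuous_re.tendsto _).comp h
    simpa [Function.comp_def] using this
  · intro h
    have := (Complex.continuous_ofReal.tendsto _).comp h
    simpa [Function.comp_def] using this

open scoped Matrix.Norms.Operator in
-- Gelfand's formula bounds ‖a ^ k‖ eventually by r ^ k for some r < 1.
lemma tendsto_pow_of_spectralRadius_lt_one {n : ℕ} {a : Matrix (Fin n) (Fin n) ℂ}
    (h : spectralRadius ℂ a < 1) : Tendsto (fun k : ℕ => a ^ k) atTop (𝓝 0) := by
  obtain ⟨r, hr, hr1⟩ := ENNReal.lt_iff_exists_nnreal_btwn.1 h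
  have hr1' : r < 1 := by exact_mod_cast hr1
  have hG := (spectrum.pow_nnnorm_pow_one_div_tendsto_nhds_spectralRadius a).eventually_lt_const hr
  have : ∀ᶠ k : ℕ in atTop, ‖a ^ k‖ ≤ (r : ℝ) ^ k := by
    filter_upwards [hG, eventually_gt_atTop 0] with k hk hk0
    have hk0' : (k : ℝ) ≠ 0 := by positivity
    have h1 := ENNReal.rpow_lt_rpow hk (z := (k : ℝ)) (by positivity)
    rw [← ENNReal.rpow_mul, one_div, inv_mul_cancel₀ hk0', ENNReal.rpow_one,
      ENNReal.rpow_natCast] at h1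
    exact_mod_cast h1.le
  exact squeeze_zero_norm' this (tendsto_pow_atTop_nhds_zero_of_lt_one r.2 (by exact_mod_cast hr1'))

open scoped Matrix.Norms.Operator in
-- ρ(a)^k ≤ ρ(a^k) ≤ ‖a^k‖ < 1 for some k > 0.
lemma spectralRadius_lt_one_of_tendsto_pow {n : ℕ} {a : Matrix (Fin n) (Fin n) ℂ}
    (h : Tendsto (fun k : ℕ => a ^ k) atTop (𝓝 0)) : spectralRadius ℂ a < 1 := by
  rcases isEmpty_or_nonempty (Fin n) with _ | _
  · rw [Subsingleton.elim a 0, spectrum.spectralRadius_zero]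
    exact one_pos
  · have h1 : ∀ᶠ k : ℕ in atTop, ‖a ^ k‖ < 1 := by
      have := h.norm
      rw [norm_zero] at this
      exact this.eventually_lt_const one_pos
    obtain ⟨k, hk, hk0⟩ := (h1.and (eventually_gt_atTop 0)).exists
    have h2 := (spectrum.spectralRadius_pow_le (𝕜 := ℂ) a k hk0.ne').trans
      (spectrum.spectralRadius_le_nnnorm (𝕜 := ℂ) (a ^ k))
    have h3 : (‖a ^ k‖₊ : ENNReal) < 1 := by exact_mod_cast hk
    by_contra hc
    exact absurd (h2.trans_lt h3) (not_lt.2 (one_le_pow_of_one_le' (not_lt.1 hc) k))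

lemma isSchurStable_iff_tendsto_pow {n : ℕ} {M : Matrix (Fin n) (Fin n) ℝ} :
    IsSchurStable M ↔ Tendsto (fun k : ℕ => M ^ k) atTop (𝓝 0) :=
  ⟨fun h => (tendsto_map_ofReal_pow_iff M).1 (tendsto_pow_of_spectralRadius_lt_one h),
    fun h => spectralRadius_lt_one_of_tendsto_pow ((tendsto_map_ofReal_pow_iff M).2 h)⟩

lemma IsSchurStable.transpose {n : ℕ} {M : Matrix (Fin n) (Fin n) ℝ} (h : IsSchurStable M) :
    IsSchurStable Mᵀ := by
  rw [isSchurStable_iff_tendsto_pow] at h ⊢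
  have := (continuous_id.matrix_transpose.tendsto (0 : Matrix (Fin n) (Fin n) ℝ)).comp h
  simpa [Function.comp_def, transpose_pow] using this

variable {n : ℕ} {M N X : Matrix (Fin n) (Fin n) ℝ}

lemma lyapunov_iterate (hX : X = M * X * Mᵀ + N) (k : ℕ) :
    X = M ^ k * X * (M ^ k)ᵀ + ∑ j ∈ Finset.range k, M ^ j * N * (M ^ j)ᵀ := by
  induction k with
  | zero => simp
  | succ k ih =>
    have h1 : M ^ k * X * (M ^ k)ᵀ = M ^ (k + 1) * X * (M ^ (k + 1))ᵀ + M ^ k * N * (M ^ k)ᵀ := by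
      conv_lhs => rw [hX]
      rw [mul_add, add_mul, pow_succ, transpose_mul]
      simp only [mul_assoc]
    rw [Finset.sum_range_succ, add_comm (∑ j ∈ _, _), ← add_assoc, ← h1]
    exact ih

lemma IsSchurStable.tendsto_conj (h : IsSchurStable M) (X : Matrix (Fin n) (Fin n) ℝ) :
    Tendsto (fun k : ℕ => M ^ k * X * (M ^ k)ᵀ) atTop (𝓝 0) := by
  have hc : Continuous fun Y : Matrix (Fin n) (Fin n) ℝ => Y * X * Yᵀ := by fun_prop
  have := (hc.tendsto 0).comp (isSchurStable_iff_tendsto_pow.1 h)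
  simpa [Function.comp_def] using this

/-- X ↦ X - M X Mᵀ is injective, as a kernel element equals M^k X (M^k)ᵀ → 0; in finite dimension it
is then surjective. -/
lemma IsSchurStable.existsUnique_lyapunov (h : IsSchurStable M) (N : Matrix (Fin n) (Fin n) ℝ) :
    ∃! X, X = M * X * Mᵀ + N := by
  let T : Matrix (Fin n) (Fin n) ℝ →ₗ[ℝ] Matrix (Fin n) (Fin n) ℝ :=
    LinearMap.id - LinearMap.mulRight ℝ Mᵀ ∘ₗ LinearMap.mulLeft ℝ M
  have hT : ∀ X, T X = X - M * X * Mᵀ := fun X => rfl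
  have hinj : Function.Injective T := by
    rw [injective_iff_map_eq_zero]
    intro X hX
    rw [hT, sub_eq_zero] at hX
    have hX' : X = M * X * Mᵀ + 0 := by rwa [add_zero]
    have hk : ∀ k : ℕ, X = M ^ k * X * (M ^ k)ᵀ := fun k => by
      simpa using lyapunov_iterate hX' k
    exact tendsto_nhds_unique (tendsto_const_nhds.congr hk) (h.tendsto_conj X)
  have key : ∀ X, X = M * X * Mᵀ + N ↔ T X = N := fun X => by rw [hT, sub_eq_iff_eq_add, add_comm]
  simp_rw [key]
  obtain ⟨X, hX⟩ := (LinearMap.injective_iff_surjective.1 hinj) N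
  exact ⟨X, hX, fun Y hY => hinj (hY.trans hX.symm)⟩

lemma IsSchurStable.lyapunov_posSemidef (h : IsSchurStable M) (hN : N.PosSemidef)
    (hX : X = M * X * Mᵀ + N) : X.PosSemidef := by
  have hlim : Tendsto (fun k : ℕ => X - M ^ k * X * (M ^ k)ᵀ) atTop (𝓝 X) := by
    simpa using tendsto_const_nhds.sub (h.tendsto_conj X)
  refine isClosed_setOf_posSemidef.mem_of_tendsto hlim (Eventually.of_forall fun k => ?_)
  have : X - M ^ k * X * (M ^ k)ᵀ = ∑ j ∈ Finset.range k, M ^ j * N * (M ^ j)ᵀ := by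
    rw [sub_eq_iff_eq_add, add_comm]
    exact lyapunov_iterate hX k
  rw [this]
  exact posSemidef_sum _ fun j _ => hN.mul_mul_transpose_same _

/-- Iterating the equation bounds ∑ tr(M^j N (M^j)ᵀ) by tr X. As N ≻ 0, the series ∑ tr((M^j)ᵀ M^j)
converges, so the entries of M^j tend to 0. -/
lemma isSchurStable_of_lyapunov (hN : N.PosDef) (hXp : X.PosSemidef)
    (hX : X = M * X * Mᵀ + N) : IsSchurStable M := by
  obtain ⟨c, hc, hcN⟩ := hN.exists_pos_trace_mul_ge
  have htr : ∀ j, (M ^ j * N * (M ^ j)ᵀ).trace = (N * ((M ^ j)ᵀ * M ^ j)).trace := fun j => by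
    rw [mul_assoc, trace_mul_comm, mul_assoc]
  have hpsd : ∀ j, ((M ^ j)ᵀ * M ^ j).PosSemidef := fun j => by
    simpa using posSemidef_conjTranspose_mul_self (M ^ j)
  have hsum : Summable fun j : ℕ => ((M ^ j)ᵀ * M ^ j).trace := by
    refine summable_of_sum_range_le (c := X.trace / c) (fun j => (hpsd j).trace_nonneg) fun k => ?_
    rw [le_div_iff₀' hc, Finset.mul_sum]
    have h1 := congrArg trace (lyapunov_iterate hX k)
    rw [trace_add, trace_sum] at h1
    have h2 := (hXp.mul_mul_transpose_same (M ^ k)).trace_nonneg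
    calc _ ≤ ∑ j ∈ Finset.range k, (M ^ j * N * (M ^ j)ᵀ).trace :=
          Finset.sum_le_sum fun j _ => by rw [htr]; exact hcN _ (hpsd j)
      _ ≤ X.trace := by linarith
  rw [isSchurStable_iff_tendsto_pow, tendsto_nhds_iff_apply]
  intro i j
  have h0 : Tendsto (fun k : ℕ => (M ^ k) i j ^ 2) atTop (𝓝 0) :=
    squeeze_zero (fun _ => sq_nonneg _)
      (fun k => sq_apply_le_trace_transpose_mul_self (M ^ k) i j) hsum.tendsto_atTop_zero
  have h1 := (Real.continuous_sqrt.tendsto _).comp h0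
  simp only [Function.comp_def, Real.sqrt_sq_eq_abs, Real.sqrt_zero] at h1
  exact (tendsto_zero_iff_abs_tendsto_zero _).2 h1

end Stability

/-! ### The unconstrained LQR problem. -/

section LQR
open Matrix

variable {n m : ℕ}

/-- Pairs `(K, X)` with `X` a positive semidefinite solution of the closed-loop Lyapunov equation
`X = (A + B K) X (A + B K)ᵀ + N`. -/
def lyapunovGraph (A : Matrix (Fin n) (Fin n) ℝ) (B : Matrix (Fin n) (Fin m) ℝ)
    (N : Matrix (Fin n) (Fin n) ℝ) : Set (Matrix (Fin m) (Fin n) ℝ × Matrix (Fin n) (Fin n) ℝ) :=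
  {p | p.2.PosSemidef ∧ p.2 = (A + B * p.1) * p.2 * (A + B * p.1)ᵀ + N}

/-- The cost `tr((Q + Kᵀ R K) X)` of a pair `(K, X)`. -/
def lqrCost (Q : Matrix (Fin n) (Fin n) ℝ) (R : Matrix (Fin m) (Fin m) ℝ)
    (p : Matrix (Fin m) (Fin n) ℝ × Matrix (Fin n) (Fin n) ℝ) : ℝ :=
  ((Q + p.1ᵀ * R * p.1) * p.2).trace

variable {A Q N : Matrix (Fin n) (Fin n) ℝ} {B : Matrix (Fin n) (Fin m) ℝ}
  {R : Matrix (Fin m) (Fin m) ℝ}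

lemma isClosed_lyapunovGraph : IsClosed (lyapunovGraph A B N) :=
  (isClosed_setOf_posSemidef.preimage continuous_snd).inter
    (isClosed_eq continuous_snd (by fun_prop))

lemma continuous_lqrCost : Continuous (lqrCost (n := n) Q R) := by
  unfold lqrCost
  fun_prop

lemma sub_posSemidef_of_mem_lyapunovGraph
    {p : Matrix (Fin m) (Fin n) ℝ × Matrix (Fin n) (Fin n) ℝ} (hp : p ∈ lyapunovGraph A B N) :
    (p.2 - N).PosSemidef := by
  have h := hp.1.mul_mul_transpose_same (A + B * p.1)
  rwa [eq_sub_iff_add_eq.2 hp.2.symm] at h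

lemma isSchurStable_of_mem_lyapunovGraph (hN : N.PosDef)
    {p : Matrix (Fin m) (Fin n) ℝ × Matrix (Fin n) (Fin n) ℝ} (hp : p ∈ lyapunovGraph A B N) :
    IsSchurStable (A + B * p.1) :=
  isSchurStable_of_lyapunov hN hp.1 hp.2

lemma exists_mem_lyapunovGraph (hN : N.PosSemidef) {K : Matrix (Fin m) (Fin n) ℝ}
    (hK : IsSchurStable (A + B * K)) : ∃ X, (K, X) ∈ lyapunovGraph A B N := by
  obtain ⟨X, hX, -⟩ := hK.existsUnique_lyapunov N
  exact ⟨X, hK.lyapunov_posSemidef hN hX, hX⟩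

/-- A weighted quadratic penalty dominates each squared entry. -/
lemma exists_pos_mul_sq_apply_le_trace (hR : R.PosDef) (hN : N.PosDef) :
    ∃ r : ℝ, 0 < r ∧ ∀ (Y : Matrix (Fin m) (Fin n) ℝ) (X : Matrix (Fin n) (Fin n) ℝ),
      (X - N).PosSemidef → ∀ i j, r * Y i j ^ 2 ≤ (Yᵀ * R * Y * X).trace := by
  obtain ⟨a, ha, hRa⟩ := hR.exists_pos_trace_mul_ge
  obtain ⟨c, hc, hNc⟩ := hN.exists_pos_trace_mul_ge
  -- With E = Yᵀ R Y: tr(E X) ≥ tr(E N) ≥ c tr E ≥ c a tr(Yᵀ Y).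
  refine ⟨c * a, mul_pos hc ha, fun Y X hX i j => ?_⟩
  have hE := hR.posSemidef.transpose_mul_mul_same Y
  have h1 := hE.trace_mul_nonneg hX
  have h2 := hNc _ hE
  have h3 : a * (Yᵀ * Y).trace ≤ (Yᵀ * R * Y).trace := by
    have := hRa (Y * Yᵀ) (by simpa using posSemidef_self_mul_conjTranspose Y)
    rw [trace_mul_comm Yᵀ Y]
    rwa [← Matrix.mul_assoc, trace_mul_comm (R * Y), ← Matrix.mul_assoc] at this
  have h4 := sq_apply_le_trace_transpose_mul_self Y i j
  rw [mul_sub, trace_sub, trace_mul_comm _ N] at h1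
  calc c * a * Y i j ^ 2 ≤ c * (a * (Yᵀ * Y).trace) := by
        rw [mul_assoc]; gcongr
    _ ≤ c * (Yᵀ * R * Y).trace := by gcongr
    _ ≤ _ := by linarith

lemma eq_zero_of_trace_nonpos (hR : R.PosDef) (hN : N.PosDef) {Y : Matrix (Fin m) (Fin n) ℝ}
    {X : Matrix (Fin n) (Fin n) ℝ} (hX : (X - N).PosSemidef)
    (h : (Yᵀ * R * Y * X).trace ≤ 0) : Y = 0 := by
  obtain ⟨r, hr, hle⟩ := exists_pos_mul_sq_apply_le_trace hR hN
  ext i j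
  have h1 := (hle Y X hX i j).trans h
  have h2 : Y i j ^ 2 ≤ 0 := nonpos_of_mul_nonpos_right h1 hr
  exact pow_eq_zero_iff two_ne_zero |>.1 (le_antisymm h2 (sq_nonneg _))

lemma lqrCost_eq (p : Matrix (Fin m) (Fin n) ℝ × Matrix (Fin n) (Fin n) ℝ) :
    lqrCost Q R p = (Q * p.2).trace + (p.1ᵀ * R * p.1 * p.2).trace := by
  rw [lqrCost, add_mul, trace_add]

lemma lqrCost_nonneg (hQ : Q.PosSemidef) (hR : R.PosSemidef)
    {p : Matrix (Fin m) (Fin n) ℝ × Matrix (Fin n) (Fin n) ℝ} (hp : p ∈ lyapunovGraph A B N) :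
    0 ≤ lqrCost Q R p :=
  (hQ.add (hR.transpose_mul_mul_same p.1)).trace_mul_nonneg hp.1

lemma isCompact_setOf_lqrCost_le (hQ : Q.PosDef) (hR : R.PosDef) (hN : N.PosDef) (c : ℝ) :
    IsCompact {p | p ∈ lyapunovGraph A B N ∧ lqrCost Q R p ≤ c} := by
  obtain ⟨q, hq, hQq⟩ := hQ.exists_pos_trace_mul_ge
  obtain ⟨r, hr, hRr⟩ := exists_pos_mul_sq_apply_le_trace hR hN
  -- Both summands of the cost are nonnegative, hence at most c: the control term bounds K and tr(Q
  -- X) bounds X.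
  let box : Set (Matrix (Fin m) (Fin n) ℝ × Matrix (Fin n) (Fin n) ℝ) :=
    (Set.univ.pi fun _ => Set.univ.pi fun _ => Set.Icc (-√(c / r)) √(c / r)) ×ˢ
      (Set.univ.pi fun _ => Set.univ.pi fun _ => Set.Icc (-(c / q)) (c / q))
  have hbox : IsCompact box :=
    (isCompact_univ_pi fun _ => isCompact_univ_pi fun _ => isCompact_Icc).prod
      (isCompact_univ_pi fun _ => isCompact_univ_pi fun _ => isCompact_Icc)
  refine hbox.of_isClosed_subset
    (isClosed_lyapunovGraph.inter (isClosed_le continuous_lqrCost continuous_const)) ?_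
  rintro p ⟨hp, hpc⟩
  rw [lqrCost_eq] at hpc
  have h1 : 0 ≤ (Q * p.2).trace := hQ.posSemidef.trace_mul_nonneg hp.1
  have h2 := (hR.posSemidef.transpose_mul_mul_same p.1).trace_mul_nonneg hp.1
  have h3 := hQq _ hp.1
  refine ⟨fun i _ j _ => ?_, fun i _ j _ => ?_⟩
  · rw [Set.mem_Icc, ← abs_le]
    refine Real.abs_le_sqrt ?_
    rw [le_div_iff₀' hr]
    have := hRr p.1 p.2 (sub_posSemidef_of_mem_lyapunovGraph hp) i j
    linarith
  · rw [Set.mem_Icc, ← abs_le]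
    refine (hp.1.abs_apply_le_trace i j).trans ?_
    rw [le_div_iff₀' hq]
    linarith

/-- The cost difference of two policies in terms of the value matrix `P` of the first one. -/
lemma lqrCost_sub_lqrCost {P : Matrix (Fin n) (Fin n) ℝ}
    {p p' : Matrix (Fin m) (Fin n) ℝ × Matrix (Fin n) (Fin n) ℝ}
    (hp : p ∈ lyapunovGraph A B N) (hp' : p' ∈ lyapunovGraph A B N)
    (hP : P = (A + B * p.1)ᵀ * P * (A + B * p.1) + (Q + p.1ᵀ * R * p.1)) :
    lqrCost Q R p' - lqrCost Q R p =
      ((Q + p'.1ᵀ * R * p'.1 + (A + B * p'.1)ᵀ * P * (A + B * p'.1) - P) * p'.2).trace := by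
  -- tr(P N) is common to all policies, so it links covariances of different closed loops.
  have hPN : ∀ q ∈ lyapunovGraph A B N,
      (P * N).trace = (P * q.2).trace - ((A + B * q.1)ᵀ * P * (A + B * q.1) * q.2).trace := by
    intro q hq
    have h1 : N = q.2 - (A + B * q.1) * q.2 * (A + B * q.1)ᵀ :=
      eq_sub_iff_add_eq'.2 hq.2.symm
    rw [h1, mul_sub, trace_sub, ← mul_assoc P, trace_mul_comm (P * _)]
    simp only [mul_assoc]
  have h2 : lqrCost Q R p = (P * N).trace := by
    rw [lqrCost, hPN p hp, eq_sub_iff_add_eq'.2 hP.symm, sub_mul, trace_sub]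
  rw [h2, hPN p' hp', lqrCost, sub_mul, add_mul (Q + p'.1ᵀ * R * p'.1), trace_sub, trace_add]
  ring

/-- Completion of squares around a policy `G` which is greedy for `P`. -/
lemma bellman_sub_bellman {P : Matrix (Fin n) (Fin n) ℝ} (hPs : Pᵀ = P) (hRs : Rᵀ = R)
    {G : Matrix (Fin m) (Fin n) ℝ} (hG : (R + Bᵀ * P * B) * G = -(Bᵀ * P * A))
    (K : Matrix (Fin m) (Fin n) ℝ) :
    Q + Kᵀ * R * K + (A + B * K)ᵀ * P * (A + B * K) =
      Q + Aᵀ * P * A - Gᵀ * (R + Bᵀ * P * B) * G + (K - G)ᵀ * (R + Bᵀ * P * B) * (K - G) := by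
  have hG' : Gᵀ * (R + Bᵀ * P * B) = -(Aᵀ * P * B) := by
    have := congrArg transpose hG
    simpa [transpose_mul, hPs, hRs, Matrix.mul_assoc] using this
  have e1 : (K - G)ᵀ * (R + Bᵀ * P * B) * (K - G) =
      Kᵀ * (R + Bᵀ * P * B) * K - Kᵀ * ((R + Bᵀ * P * B) * G)
        - Gᵀ * (R + Bᵀ * P * B) * K + Gᵀ * (R + Bᵀ * P * B) * G := by
    simp only [transpose_sub, Matrix.sub_mul, Matrix.mul_sub, Matrix.mul_assoc]
    abel
  rw [e1, hG, hG']
  simp only [transpose_add, transpose_mul, Matrix.add_mul, Matrix.mul_add, Matrix.mul_assoc,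
    Matrix.neg_mul, Matrix.mul_neg]
  abel

/-- The LQR problem has a unique minimizer. -/
lemma exists_unique_lqrCost_minimizer (hQ : Q.PosDef) (hR : R.PosDef) (hN : N.PosDef)
    (hne : (lyapunovGraph A B N).Nonempty) :
    ∃ p ∈ lyapunovGraph A B N, (∀ q ∈ lyapunovGraph A B N, lqrCost Q R p ≤ lqrCost Q R q) ∧
      ∀ q ∈ lyapunovGraph A B N, lqrCost Q R q ≤ lqrCost Q R p → q = p := by
  obtain ⟨p₀, hp₀⟩ := hne
  obtain ⟨p, ⟨hp, hpp₀⟩, hmin⟩ := (isCompact_setOf_lqrCost_le hQ hR hN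
    (lqrCost Q R p₀)).exists_isMinOn ⟨p₀, hp₀, le_rfl⟩ continuous_lqrCost.continuousOn
  have hpmin : ∀ q ∈ lyapunovGraph A B N, lqrCost Q R p ≤ lqrCost Q R q := fun q hq => by
    rcases le_total (lqrCost Q R q) (lqrCost Q R p₀) with h | h
    · exact hmin ⟨hq, h⟩
    · exact hpp₀.trans h
  refine ⟨p, hp, hpmin, ?_⟩
  have hst := isSchurStable_of_mem_lyapunovGraph hN hp
  have hQK : ∀ K : Matrix (Fin m) (Fin n) ℝ, (Q + Kᵀ * R * K).PosDef := fun K =>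
    hQ.add_posSemidef (hR.posSemidef.transpose_mul_mul_same K)
  obtain ⟨P, hP, -⟩ := hst.transpose.existsUnique_lyapunov (Q + p.1ᵀ * R * p.1)
  have hPp : P.PosSemidef := hst.transpose.lyapunov_posSemidef (hQK p.1).posSemidef hP
  rw [transpose_transpose] at hP
  have hPs : Pᵀ = P := by simpa using hPp.isHermitian.eq
  have hRs : Rᵀ = R := by simpa using hR.isHermitian.eq
  have hS : (R + Bᵀ * P * B).PosDef := hR.add_posSemidef (hPp.transpose_mul_mul_same B)
  set S := R + Bᵀ * P * B with hSdef
  have hG : S * (-(S⁻¹ * (Bᵀ * P * A))) = -(Bᵀ * P * A) := by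
    rw [Matrix.mul_neg, ← Matrix.mul_assoc,
      mul_nonsing_inv _ ((isUnit_iff_isUnit_det _).1 hS.isUnit), Matrix.one_mul]
  set G := -(S⁻¹ * (Bᵀ * P * A))
  obtain ⟨C, hbell⟩ : ∃ C, ∀ K : Matrix (Fin m) (Fin n) ℝ,
      Q + Kᵀ * R * K + (A + B * K)ᵀ * P * (A + B * K) = C + (K - G)ᵀ * S * (K - G) :=
    ⟨_, bellman_sub_bellman hPs hRs hG⟩
  have hbellG : Q + Gᵀ * R * G + (A + B * G)ᵀ * P * (A + B * G) = C := by
    rw [hbell G, sub_self, Matrix.mul_zero, add_zero]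
  have hPK := hbell p.1
  rw [add_comm (Q + _), ← hP] at hPK
  have hE := hS.posSemidef.transpose_mul_mul_same (p.1 - G)
  -- The value matrix P of the minimizer also solves a Lyapunov equation for the greedy policy G,
  -- with a positive definite source.
  have hGst : IsSchurStable (A + B * G) := by
    have h1 : P = (A + B * G)ᵀ * P * (A + B * G)ᵀᵀ +
        (Q + Gᵀ * R * G + (p.1 - G)ᵀ * S * (p.1 - G)) := by
      calc P = C + (p.1 - G)ᵀ * S * (p.1 - G) := hPK
        _ = _ := by rw [← hbellG, transpose_transpose]; abel
    have := (isSchurStable_of_lyapunov ((hQK G).add_posSemidef hE) hPp h1).transpose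
    rwa [transpose_transpose] at this
  obtain ⟨X, hX⟩ := exists_mem_lyapunovGraph hN.posSemidef hGst
  -- Switching to G changes the cost by -tr((K - G)ᵀ S (K - G) X), where K = `p.1`; minimality
  -- forces this to vanish, so P = C.
  have hpG : p.1 - G = 0 := by
    refine eq_zero_of_trace_nonpos hS hN (sub_posSemidef_of_mem_lyapunovGraph hX) ?_
    have h1 := lqrCost_sub_lqrCost hp hX hP
    have h2 := hpmin _ hX
    have h3 : C - P = -((p.1 - G)ᵀ * S * (p.1 - G)) := by
      rw [← neg_sub, neg_inj, sub_eq_iff_eq_add']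
      exact hPK
    rw [hbellG, h3, neg_mul, trace_neg] at h1
    linarith
  rw [hpG, Matrix.mul_zero, add_zero] at hPK
  -- Now that P = C, the excess cost of q is exactly tr((q.1 - G)ᵀ S (q.1 - G) q.2).
  intro q hq hqp
  have hqG : q.1 - G = 0 := by
    refine eq_zero_of_trace_nonpos hS hN (sub_posSemidef_of_mem_lyapunovGraph hq) ?_
    have h1 := lqrCost_sub_lqrCost hp hq hP
    rw [hbell q.1, ← hPK, add_sub_cancel_left] at h1
    linarith
  have h1 : q.1 = p.1 := (sub_eq_zero.1 hqG).trans (sub_eq_zero.1 hpG).symm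
  refine Prod.ext h1 ((hst.existsUnique_lyapunov N).unique ?_ hp.2)
  have := hq.2
  rwa [h1] at this

end LQR

/-! ### Minimizers of f + l g as functions of the multiplier l. -/

section ParametricMinimization
open Set

variable {X : Type*} [TopologicalSpace X] {s : Set X} {f g : X → ℝ} {x : ℝ → X}

/-- Penalized minimizers depend continuously on the multiplier. -/
lemma continuousWithinAt_penalized_minimizer (hf : Continuous f) (hg : Continuous g)
    (hg0 : ∀ p ∈ s, 0 ≤ g p) (hc : ∀ c, IsCompact {p | p ∈ s ∧ f p ≤ c})
    (hx : ∀ l, 0 ≤ l → x l ∈ s ∧ ∀ p ∈ s, f (x l) + l * g (x l) ≤ f p + l * g p)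
    (huniq : ∀ l, 0 ≤ l → ∀ p ∈ s, f p + l * g p ≤ f (x l) + l * g (x l) → p = x l)
    {l₀ : ℝ} (hl₀ : 0 ≤ l₀) : ContinuousWithinAt x (Ici 0) l₀ := by
  have hmem : ∀ᶠ l in 𝓝[Ici 0] l₀, l ∈ Ici (0 : ℝ) := self_mem_nhdsWithin
  have hlt : ∀ᶠ l in 𝓝[Ici 0] l₀, l < l₀ + 1 :=
    nhdsWithin_le_nhds (eventually_lt_nhds (lt_add_one l₀))
  -- For 0 ≤ l < l₀ + 1, comparison with `x 0` keeps `x l` in this compact sublevel set; it remains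
  -- to identify the cluster points.
  refine (hc (f (x 0) + (l₀ + 1) * g (x 0))).tendsto_nhds_of_unique_mapClusterPt ?_ ?_
  · filter_upwards [hmem, hlt] with l hl hl'
    have h0 := hx 0 le_rfl
    have h1 := (hx l hl).2 _ h0.1
    have h2 := mul_nonneg hl (hg0 _ (hx l hl).1)
    have h3 := mul_le_mul_of_nonneg_right hl'.le (hg0 _ h0.1)
    exact ⟨(hx l hl).1, by linarith⟩
  · rintro z ⟨hzs, -⟩ hz
    refine huniq l₀ hl₀ z hzs ?_
    by_contra! hlt'
    -- If z were not optimal at l₀, then `x l₀` would beat `x l` for some l near l₀ with `x l` near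
    -- z.
    have hopen : IsOpen {q : ℝ × X | f (x l₀) + q.1 * g (x l₀) < f q.2 + q.1 * g q.2} :=
      isOpen_lt (by fun_prop) (by fun_prop)
    obtain ⟨U, hU, V, hV, hUV⟩ := mem_nhds_prod_iff.1 (hopen.mem_nhds (x := (l₀, z)) hlt')
    have hfr : ∃ᶠ l in 𝓝[Ici 0] l₀, x l ∈ V := mapClusterPt_iff_frequently.1 hz V hV
    obtain ⟨l, hlV, hlU, hl⟩ := (hfr.and_eventually
      (Eventually.and (mem_nhdsWithin_of_mem_nhds hU) hmem)).exists
    exact absurd ((hx l hl).2 _ (hx l₀ hl₀).1) (not_le.2 (hUV (mk_mem_prod hlU hlV)))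

/-- Under Slater's condition there is a least multiplier whose penalized minimizer is feasible,
and complementary slackness holds for it. -/
lemma exists_isLeast_multiplier (hf : Continuous f) (hg : Continuous g)
    (hf0 : ∀ p ∈ s, 0 ≤ f p)
    (hg0 : ∀ p ∈ s, 0 ≤ g p) (hc : ∀ c, IsCompact {p | p ∈ s ∧ f p ≤ c})
    (hx : ∀ l, 0 ≤ l → x l ∈ s ∧ ∀ p ∈ s, f (x l) + l * g (x l) ≤ f p + l * g p)
    (huniq : ∀ l, 0 ≤ l → ∀ p ∈ s, f p + l * g p ≤ f (x l) + l * g (x l) → p = x l)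
    {b : ℝ} (hslater : ∃ p ∈ s, g p < b) :
    ∃ l, IsLeast {l | 0 ≤ l ∧ g (x l) ≤ b} l ∧ l * (g (x l) - b) = 0 := by
  have hcont : ContinuousOn (fun l => g (x l)) (Ici 0) := fun l hl =>
    hg.continuousAt.comp_continuousWithinAt
      (continuousWithinAt_penalized_minimizer hf hg hg0 hc hx huniq hl)
  set S := {l | 0 ≤ l ∧ g (x l) ≤ b} with hS
  have hclosed : IsClosed S := hcont.preimage_isClosed_of_isClosed isClosed_Ici isClosed_Iic
  have hne : S.Nonempty := by
    obtain ⟨p, hp, hpb⟩ := hslater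
    have hd : 0 < b - g p := sub_pos.2 hpb
    have hl : 0 ≤ f p / (b - g p) := div_nonneg (hf0 p hp) hd.le
    set l := f p / (b - g p)
    have hlm : l * (b - g p) = f p := div_mul_cancel₀ _ hd.ne'
    have hl1 : (0 : ℝ) ≤ l + 1 := by linarith
    -- If `x (l + 1)` were infeasible, comparison with the Slater point p would give (l + 1)(b - g
    -- p) ≤ f p = l (b - g p); the extra 1 makes this absurd.
    refine ⟨l + 1, hl1, ?_⟩
    by_contra! hlt
    have h1 := (hx _ hl1).2 p hp
    have h2 := hf0 _ (hx _ hl1).1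
    have h3 : (l + 1) * b ≤ (l + 1) * g (x (l + 1)) := mul_le_mul_of_nonneg_left hlt.le hl1
    linarith
  have hbdd : BddBelow S := ⟨0, fun l hl => hl.1⟩
  have hleast : IsLeast S (sInf S) := ⟨hclosed.csInf_mem hne hbdd, fun l hl => csInf_le hbdd hl⟩
  refine ⟨sInf S, hleast, ?_⟩
  set l₀ := sInf S
  rcases hleast.1.1.eq_or_lt with h0 | h0
  · rw [← h0, zero_mul]
  · rcases hleast.1.2.eq_or_lt with hb | hb
    · rw [hb, sub_self, mul_zero]
    · exfalso
      -- An inactive constraint at l₀ > 0 would stay satisfied slightly to the left, contradicting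
      -- leastness.
      have hev : ∀ᶠ l in 𝓝 l₀, g (x l) < b :=
        (hcont.continuousAt (Ici_mem_nhds h0)).eventually_lt_const hb
      obtain ⟨l, hl, hl1, hl2⟩ := (hev.filter_mono (nhdsWithin_le_nhds (s := Iio l₀)) |>.and
        (Eventually.and (mem_nhdsWithin_of_mem_nhds (Ioi_mem_nhds h0))
          self_mem_nhdsWithin)).exists
      exact absurd (hleast.2 ⟨le_of_lt hl1, hl.le⟩) (not_le.2 hl2)

end ParametricMinimization

open Set

/-! ### Full row rank of H and controllability. -/

namespace Matrix

lemma vecMul_injective_of_rank_eq {n d : ℕ} {H : Matrix (Fin n) (Fin d) ℝ} (hH : H.rank = n) :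
    Function.Injective H.vecMul := by
  rw [vecMul_injective_iff, linearIndependent_iff_card_eq_finrank_span, Set.finrank,
    ← rank_eq_finrank_span_row, hH, Fintype.card_fin]

end Matrix

/-- The zeroth block of the controllability matrix is H itself, already of rank n. For n = 0 there
is no such block. -/
lemma isControllablePair_of_rank_eq {n d : ℕ} {H : Matrix (Fin n) (Fin d) ℝ} (hH : H.rank = n)
    (M : Matrix (Fin n) (Fin n) ℝ) : IsControllablePair M H := by
  rcases Nat.eq_zero_or_pos n with rfl | hn
  · have h := (controllabilityMatrix M H).rank_le_card_height
    rw [Fintype.card_fin] at h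
    exact Nat.le_zero.1 h
  · have hsub : H = (controllabilityMatrix M H).submatrix id fun j => (⟨0, hn⟩, j) := by
      ext i j
      simp [controllabilityMatrix]
    refine le_antisymm ?_ ?_
    · simpa using (controllabilityMatrix M H).rank_le_card_height
    · have hinj : Function.Injective (controllabilityMatrix M H).vecMul := by
        intro v w hvw
        refine Matrix.vecMul_injective_of_rank_eq hH ?_
        ext j
        have := congrFun hvw (⟨0, hn⟩, j)
        simpa [Matrix.vecMul, dotProduct, controllabilityMatrix] using this
      rw [Matrix.vecMul_injective_iff] at hinj
      rw [hinj.rank_matrix, Fintype.card_fin]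

/-! ### The Lagrangian as an LQR cost. -/

namespace LQRData

open Matrix

variable {n m d : ℕ} {D : LQRData n m d} {β : ℝ}

lemma noiseCov_posDef (hH : D.H.rank = n) (hnoise : IsAdmissibleNoise D.noise) :
    D.noiseCov.PosDef := by
  have := hnoise.cov_posDef.mul_mul_conjTranspose_same (vecMul_injective_of_rank_eq hH)
  simpa [noiseCov] using this

lemma existsUnique_isStateCov (hN : D.noiseCov.PosDef) {K : Matrix (Fin m) (Fin n) ℝ}
    (hK : K ∈ D.stabilizing) : ∃! X, D.IsStateCov K X := by
  obtain ⟨X, hX⟩ := exists_mem_lyapunovGraph hN.posSemidef hK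
  refine ⟨X, ⟨?_, hX.2⟩, fun Y hY => (IsSchurStable.existsUnique_lyapunov hK _).unique hY.2 hX.2⟩
  -- X = (X - N) + N upgrades semidefinite to definite.
  simpa using PosDef.posSemidef_add (sub_posSemidef_of_mem_lyapunovGraph hX) hN

/-- The graph of `K ↦ Σ_K` on the stabilizing policies, as a solution set. -/
lemma mem_lyapunovGraph_iff (hN : D.noiseCov.PosDef) {K : Matrix (Fin m) (Fin n) ℝ}
    {X : Matrix (Fin n) (Fin n) ℝ} :
    (K, X) ∈ lyapunovGraph D.A D.B D.noiseCov ↔ K ∈ D.stabilizing ∧ X = D.stateCov K := by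
  have hspec : ∀ K ∈ D.stabilizing, D.IsStateCov K (D.stateCov K) := fun K hK =>
    Classical.epsilon_spec (existsUnique_isStateCov hN hK).exists
  constructor
  · intro h
    have hst : IsSchurStable (D.A + D.B * K) :=
      isSchurStable_of_mem_lyapunovGraph (p := (K, X)) hN h
    have hK : K ∈ D.stabilizing := hst
    have hX : X = D.closedLoop K * X * (D.closedLoop K)ᵀ + D.noiseCov := h.2
    have hu : ∃! Y, Y = D.closedLoop K * Y * (D.closedLoop K)ᵀ + D.noiseCov :=
      IsSchurStable.existsUnique_lyapunov hK _
    exact ⟨hK, hu.unique hX (hspec K hK).2⟩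
  · rintro ⟨hK, rfl⟩
    exact ⟨(hspec K hK).1.posSemidef, (hspec K hK).2⟩

/-- The weight `4 Qᶜ N Qᶜ`, with `N` the state noise covariance, by which the risk constraint
enters the Lagrangian. -/
noncomputable def riskWeight (D : LQRData n m d) : Matrix (Fin n) (Fin n) ℝ :=
  (4 : ℝ) • (D.Qc * D.noiseCov * D.Qc)

lemma riskWeight_posSemidef (hN : D.noiseCov.PosDef) (hQc : D.Qc.PosSemidef) :
    D.riskWeight.PosSemidef := by
  have h := hN.posSemidef.transpose_mul_mul_same D.Qc
  have hs : D.Qcᵀ = D.Qc := by simpa using hQc.isHermitian.eq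
  rw [hs] at h
  exact h.smul (by norm_num)

/-- The part of `γ_N²` which does not depend on the policy when `R^c = 0`. -/
noncomputable def riskOffset (D : LQRData n m d) : ℝ :=
  D.m4 D.Qc - (D.riskWeight * D.noiseCov).trace

lemma gammaNSq_eq (hRc : D.Rc = 0) (K : Matrix (Fin m) (Fin n) ℝ) :
    D.gammaNSq K = (D.riskWeight * D.stateCov K).trace + D.riskOffset := by
  have h : D.QcK K = D.Qc := by simp [QcK, hRc]
  rw [gammaNSq, h, riskOffset, riskWeight, mul_sub, trace_sub]
  simp only [smul_mul_assoc, trace_smul, smul_eq_mul]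
  ring

/-- The multiplier only shifts the state weight, so LQR theory applies for each l ≥ 0. -/
lemma lagrangian_eq (hRc : D.Rc = 0) (K : Matrix (Fin m) (Fin n) ℝ) (l : ℝ) :
    D.lagrangian β K l = lqrCost (D.Q + l • D.riskWeight) D.R (K, D.stateCov K) +
      l * (D.riskOffset - β) := by
  rw [lagrangian, gammaNSq_eq hRc, cost, QK, lqrCost]
  simp only [add_mul, trace_add, smul_mul_assoc, trace_smul, smul_eq_mul]
  ring

lemma existsUnique_isLagrangianMinimizer (hQ : D.Q.PosDef) (hR : D.R.PosDef)
    (hQc : D.Qc.PosSemidef) (hRc : D.Rc = 0) (hN : D.noiseCov.PosDef)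
    (hne : D.stabilizing.Nonempty) {l : ℝ} (hl : 0 ≤ l) :
    ∃! K, D.IsLagrangianMinimizer β l K := by
  have hQl : (D.Q + l • D.riskWeight).PosDef :=
    hQ.add_posSemidef ((riskWeight_posSemidef hN hQc).smul hl)
  obtain ⟨K₀, hK₀⟩ := hne
  obtain ⟨⟨K, X⟩, hp, hmin, huniq⟩ := exists_unique_lqrCost_minimizer hQl hR hN
    ⟨_, (mem_lyapunovGraph_iff hN).2 ⟨hK₀, rfl⟩⟩
  obtain ⟨hK, rfl⟩ := (mem_lyapunovGraph_iff hN).1 hp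
  refine ⟨K, ⟨hK, fun K' hK' => ?_⟩, fun K' hK' => ?_⟩
  · rw [lagrangian_eq hRc, lagrangian_eq hRc]
    have := hmin _ ((mem_lyapunovGraph_iff hN).2 ⟨hK', rfl⟩)
    linarith
  · have h := hK'.2 K hK
    rw [lagrangian_eq hRc, lagrangian_eq hRc] at h
    exact congrArg Prod.fst (huniq (K', D.stateCov K')
      ((mem_lyapunovGraph_iff hN).2 ⟨hK'.1, rfl⟩) (by linarith))

end LQRData

/-! ### Saddle point and strong duality. -/

open LQRData in
theorem mainTheorem3 {n m d : ℕ} (D : LQRData n m d) (β : ℝ)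
    (hQ : D.Q.PosDef) (hR : D.R.PosDef) (hQc : D.Qc.PosSemidef) (hRc : D.Rc = 0)
    (hH : D.H.rank = n) (hnoise : IsAdmissibleNoise D.noise)
    (hslater : ∃ K ∈ D.stabilizing, D.gammaNSq K < β) :
    -- well-definedness of `Σ_K` on the stabilizing set and of `K*(lam)` for `lam ≥ 0`
    (∀ K ∈ D.stabilizing, ∃! X, D.IsStateCov K X) ∧
    (∀ lam : ℝ, 0 ≤ lam → ∃! K, D.IsLagrangianMinimizer β lam K) ∧
    ∃ lamStar : ℝ,
      -- `lamStar` is the smallest multiplier whose optimal policy satisfies the constraint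
      IsLeast {lam : ℝ | 0 ≤ lam ∧ D.gammaNSq (D.optPolicy β lam) ≤ β} lamStar ∧
      D.IsLagrangianSaddlePoint β (D.optPolicy β lamStar) lamStar ∧
      -- complementary slackness
      lamStar * (D.gammaNSq (D.optPolicy β lamStar) - β) = 0 ∧
      -- strong duality: both problems are solved, with the same value
      D.optPolicy β lamStar ∈ D.feasible β ∧
      IsLeast (D.cost '' D.feasible β) (D.cost (D.optPolicy β lamStar)) ∧
      IsGreatest (D.dualFunction β '' Set.Ici 0) (D.cost (D.optPolicy β lamStar)) ∧
      D.dualFunction β lamStar = D.cost (D.optPolicy β lamStar) := by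
  have hN := noiseCov_posDef hH hnoise
  have hW := riskWeight_posSemidef hN hQc
  have hne : D.stabilizing.Nonempty := hslater.imp fun _ h => h.1
  have hmin : ∀ l : ℝ, 0 ≤ l → ∃! K, D.IsLagrangianMinimizer β l K := fun l hl =>
    existsUnique_isLagrangianMinimizer hQ hR hQc hRc hN hne hl
  have hopt : ∀ l : ℝ, 0 ≤ l → D.IsLagrangianMinimizer β l (D.optPolicy β l) := fun l hl =>
    Classical.epsilon_spec (hmin l hl).exists
  refine ⟨fun K hK => existsUnique_isStateCov hN hK, hmin, ?_⟩
  -- The policy-independent offset is moved into the bound, leaving a penalty that is nonnegative on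
  -- the graph.
  let g : Matrix (Fin m) (Fin n) ℝ × Matrix (Fin n) (Fin n) ℝ → ℝ :=
    fun p => (D.riskWeight * p.2).trace
  have hgam : ∀ K, D.gammaNSq K = g (K, D.stateCov K) + D.riskOffset := gammaNSq_eq hRc
  have hlag : ∀ K l, D.lagrangian β K l = lqrCost D.Q D.R (K, D.stateCov K) +
      l * g (K, D.stateCov K) + l * (D.riskOffset - β) := fun K l => by
    rw [lagrangian, hgam, cost, QK, lqrCost]
    ring
  have hgraph := @mem_lyapunovGraph_iff n m d D hN
  obtain ⟨l, hl, hslack⟩ := exists_isLeast_multiplier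
    (s := lyapunovGraph D.A D.B D.noiseCov) (f := lqrCost D.Q D.R) (g := g)
    (x := fun l => (D.optPolicy β l, D.stateCov (D.optPolicy β l))) (b := β - D.riskOffset)
    continuous_lqrCost (by fun_prop)
    (fun p hp => lqrCost_nonneg hQ.posSemidef hR.posSemidef hp)
    (fun p hp => hW.trace_mul_nonneg hp.1)
    (isCompact_setOf_lqrCost_le hQ hR hN)
    (fun l hl => ⟨hgraph.2 ⟨(hopt l hl).1, rfl⟩, by
      rintro ⟨K, X⟩ hp
      obtain ⟨hK, rfl⟩ := hgraph.1 hp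
      have := (hopt l hl).2 K hK
      rw [hlag, hlag] at this
      linarith⟩)
    (fun l hl => by
      rintro ⟨K, X⟩ hp hle
      obtain ⟨hK, rfl⟩ := hgraph.1 hp
      have hKmin : D.IsLagrangianMinimizer β l K := ⟨hK, fun K' hK' => by
        have := (hopt l hl).2 K' hK'
        rw [hlag, hlag] at this ⊢
        linarith⟩
      rw [(hmin l hl).unique hKmin (hopt l hl)])
    (by
      obtain ⟨K, hK, hlt⟩ := hslater
      rw [hgam] at hlt
      exact ⟨_, hgraph.2 ⟨hK, rfl⟩, by linarith⟩)
  simp only [le_sub_iff_add_le, ← hgam] at hl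
  rw [sub_sub_eq_add_sub, ← hgam] at hslack
  have hl0 : 0 ≤ l := hl.1.1
  have hfeas : D.gammaNSq (D.optPolicy β l) ≤ β := hl.1.2
  have hL : D.lagrangian β (D.optPolicy β l) l = D.cost (D.optPolicy β l) := by
    rw [lagrangian, hslack, add_zero]
  have hleK : ∀ l', 0 ≤ l' → D.lagrangian β (D.optPolicy β l) l' ≤ D.cost (D.optPolicy β l) :=
    fun l' hl' => by
      have := mul_nonpos_of_nonneg_of_nonpos hl' (sub_nonpos.2 hfeas)
      rw [lagrangian]
      linarith
  -- The infimum is attained, so `sInf` takes no default value here.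
  have hdual : ∀ l', 0 ≤ l' →
      D.dualFunction β l' = D.lagrangian β (D.optPolicy β l') l' := fun l' hl' =>
    IsLeast.csInf_eq ⟨mem_image_of_mem _ (hopt l' hl').1,
      forall_mem_image.2 fun K hK => (hopt l' hl').2 K hK⟩
  have hmem : D.optPolicy β l ∈ D.feasible β :=
    ⟨(hopt l hl0).1, isControllablePair_of_rank_eq hH _, hfeas⟩
  refine ⟨l, hl, ⟨(hopt l hl0).1, hl0, fun K hK l' hl' => ?_⟩, hslack, hmem,
    ⟨mem_image_of_mem _ hmem, forall_mem_image.2 fun K hK => ?_⟩,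
    ⟨⟨l, hl0, (hdual l hl0).trans hL⟩, forall_mem_image.2 fun l' hl' => ?_⟩,
    (hdual l hl0).trans hL⟩
  · exact (hleK l' hl').trans (hL.symm.trans_le ((hopt l hl0).2 K hK))
  -- J(K*) = L(K*, l) ≤ L(K, l) ≤ J(K) for feasible K.
  · have h1 := (hopt l hl0).2 K hK.1
    have h2 := mul_nonpos_of_nonneg_of_nonpos hl0 (sub_nonpos.2 hK.2.2)
    rw [hL, lagrangian] at h1
    linarith
  · rw [hdual l' hl']
    exact ((hopt l' hl').2 _ (hopt l hl0).1).trans (hleK l' hl')
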